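/- Let $c_i\in\mathbb{R}[x]=\mathbb{R}[x_1,\dots,x_n]$ for $i\in\mathcal{E}\cup\mathcal{I}$, where $\mathcal{E},\mathcal{I}$ are finite label sets, and let $$K=\{x\in\mathbb{R}^n:\ c_i(x)=0\ (i\in\mathcal{E}),\ c_j(x)\ge 0\ (j\in\mathcal{I})\}.$$ Write $\tilde x=(x_0,x)$, $\tilde p(\tilde x)=x_0^{\deg p}\,p(x/x_0)$ for the homogenization of a polynomial $p$, and $$\widetilde K=\{\tilde x\in\mathbb{R}^{n+1}:\ \tilde c_i(\tilde x)=0\ (i\in\mathcal{E}),\ \tilde c_j(\tilde x)\ge 0\ (j\in\mathcal{I}),\ x_0\ge 0,\ x_0^2+x^Tx=1\}.$$ For a finite set $\mathcal{B}\subseteq\mathbb{N}^N$ and a closed set $S\subseteq\mathbb{R}^N$, let $\mathbb{R}[z]_{\mathcal B}$ be the span of the monomials $z^\alpha$ ($\alpha\in\mathcal B$), and put $\langle p,y\rangle=\sum_{\alpha\in\mathcal B}p_\alpha y_\alpha$ for $p\in\mathbb{R}[z]_{\mathcal B}$ and $y\in\mathbb{R}^{\mathcal B}$. An $S$-representing measure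 of $y\in\mathbb{R}^{\mathcal B}$ is a Borel measure $\mu$ on $\mathbb{R}^N$ with $\operatorname{supp}\mu\subseteq S$ and $y_\alpha=\int z^\alpha\,d\mu$ (all these moments existing) for every $\alpha\in\mathcal B$. Let $\mathscr{R}_{\mathcal B}(S)$ be the set of all $y\in\mathbb{R}^{\mathcal B}$ that have an $S$-representing measure, and let $\mathscr{P}_{\mathcal B}(S)$ be the set of all $p\in\mathbb{R}[z]_{\mathcal B}$ that are nonnegative on $S$. When $\mathcal B=\{\alpha\in\mathbb{N}^N:|\alpha|\le k\}$, write $\mathbb{R}[z]_k$, $\mathscr{R}_k(S)$, $\mathscr{P}_k(S)$; let $\Sigma[z]_k$ be the set of polynomials in $\mathbb{R}[z]_k$ that are sums of squares of polynomials. A measure is $r$-atomic if its support consists of exactly $r$ points. Let $\mathcal A\subseteq\mathbb{N}^n$ be finite, $d=\max\{|\alpha|:\alpha\in\mathcal A\}$ (with $d=0$ if $\mathcal A=\emptyset$), $0\le m_1\le m$, $a_1,\dots,a_m\in\mathbb{R}[x]_{\mathcal A}$ and $b_1,\dots,b_m\in\mathbb{R}$. Put $\hat a_i(\tilde x)=x_0^d\,a_i(x/x_0)$.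 Let $d_1>d$ be even, and suppose that there exists $y\in\mathscr{R}_{\mathcal A}(K)$ with $\langle a_i,y\rangle=b_i$ for $1\le i\le m_1$ and $\langle a_i,y\rangle\ge b_i$ for $m_1<i\le m$. For $f\in\mathbb{R}[\tilde x]_{d_1}$ consider the problem $$(\mathrm P_f)\qquad \min\ \langle f,w\rangle\quad\text{s.t.}\quad \langle\hat a_i,w\rangle=b_i\ (1\le i\le m_1),\quad \langle\hat a_i,w\rangle\ge b_i\ (m_1<i\le m),\quad w\in\mathscr{R}_{d_1}(\widetilde K)$$ and its dual $$(\mathrm D_f)\qquad \max\ \sum_{i=1}^m b_i\theta_i\quad\text{s.t.}\quad f-\sum_{i=1}^m\theta_i\hat a_i\in\mathscr{P}_{d_1}(\widetilde K),\quad \theta_i\ge 0\ (m_1<i\le m).$$ (i) If $f$ lies in the interior of $\Sigma[\tilde x]_{d_1}$ in the finite-dimensional space $\mathbb{R}[\tilde x]_{d_1}$, then strong duality holds and the minimum of $(\mathrm P_f)$ is attained: the minimum value of $(\mathrm P_f)$ exists and is equal to the supremum of $(\mathrm D_f)$ (taken over a nonempty feasible set). (ii) For generic $f\in\Sigma[\tilde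 x]_{d_1}$, that is, for all $f\in\Sigma[\tilde x]_{d_1}$ outside a set of Lebesgue measure zero in the coefficient space $\mathbb{R}[\tilde x]_{d_1}$, the problem $(\mathrm P_f)$ has a unique minimizer $w^*$, and every $\widetilde K$-representing measure of $w^*$ is $r$-atomic for some $r\le m$. -/

import Mathlib

open MeasureTheory

noncomputable section

namespace GTMP

/-- The power set `ℕ^N_k` of all exponents of total degree at most `k` in `N` variables. -/
def powers (N k : ℕ) : Finset (Fin N →₀ ℕ) :=
  (Finset.range (k + 1)).biUnion fun j => (Finset.univ : Finset (Fin N)).finsuppAntidiag j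

theorem mem_powers {N k : ℕ} {α : Fin N →₀ ℕ} : α ∈ powers N k ↔ α.degree ≤ k := by
  simp [powers, Finset.mem_finsuppAntidiag, Finsupp.degree_eq_sum]

/-- The degree of a finite power set: the largest total degree of its elements. -/
def setDegree {N : ℕ} (A : Finset (Fin N →₀ ℕ)) : ℕ := A.sup fun α => α.degree

/-- The polynomial in `ℝ[x]_A` with the given vector of coefficients. -/
def ofCoeffs {N : ℕ} {A : Finset (Fin N →₀ ℕ)} (c : A → ℝ) : MvPolynomial (Fin N) ℝ :=
  ∑ α : A, MvPolynomial.monomial (α : Fin N →₀ ℕ) (c α)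

/-- The pairing `⟨p, y⟩ = ∑ p_α y_α` (sum over `α ∈ A`) of `p ∈ ℝ[x]_A` with `y ∈ ℝ^A`. -/
def pairing {N : ℕ} {A : Finset (Fin N →₀ ℕ)} (p : MvPolynomial (Fin N) ℝ) (y : A → ℝ) : ℝ :=
  ∑ α : A, p.coeff (α : Fin N →₀ ℕ) * y α

/-- `meas(y, K)`: the Borel measures `μ` on `ℝ^N` with `supp μ ⊆ K` whose moments of all the
orders `α ∈ A` exist and are given by `y`. -/
def repMeasures {N : ℕ} {A : Finset (Fin N →₀ ℕ)} (y : A → ℝ) (K : Set (Fin N → ℝ)) :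
    Set (Measure (Fin N → ℝ)) :=
  {μ | μ.support ⊆ K ∧ ∀ α : A,
    Integrable (fun x : Fin N → ℝ => ∏ i, x i ^ (α : Fin N →₀ ℕ) i) μ ∧
      y α = ∫ x, ∏ i, x i ^ (α : Fin N →₀ ℕ) i ∂μ}

/-- The truncated moment cone `R_A(K)`. -/
def momentCone {N : ℕ} (A : Finset (Fin N →₀ ℕ)) (K : Set (Fin N → ℝ)) : Set (A → ℝ) :=
  {y | (repMeasures y K).Nonempty}

/-- The cone `P_A(K)` of polynomials in `ℝ[x]_A` that are nonnegative on `K`. -/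
def nonnegCone {N : ℕ} (A : Finset (Fin N →₀ ℕ)) (K : Set (Fin N → ℝ)) :
    Set (MvPolynomial (Fin N) ℝ) :=
  {p | p ∈ MvPolynomial.restrictSupport ℝ (A : Set (Fin N →₀ ℕ)) ∧
    ∀ x ∈ K, 0 ≤ MvPolynomial.eval x p}

/-- The truncation `Σ[x]_k` of the cone of sums of squares, as a set of coefficient vectors in
the finite-dimensional space `ℝ[x]_k ≅ ℝ^{ℕ^N_k}`. -/
def sosCone (N k : ℕ) : Set (powers N k → ℝ) := {c | IsSumSq (ofCoeffs c)}

/-- The degree-`D` homogenization `x₀^D p(x / x₀)` of a polynomial `p` of degree at most `D`;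
the variable `x₀` has index `0` and `x₁, …, x_n` become the variables `1, …, n`. -/
def homogenize {n : ℕ} (D : ℕ) (p : MvPolynomial (Fin n) ℝ) : MvPolynomial (Fin (n + 1)) ℝ :=
  ∑ α ∈ p.support, MvPolynomial.monomial (Finsupp.cons (D - α.degree) α) (p.coeff α)

/-- The homogenization `p̃ = x₀^{deg p} p(x / x₀)`. -/
def hom {n : ℕ} (p : MvPolynomial (Fin n) ℝ) : MvPolynomial (Fin (n + 1)) ℝ :=
  homogenize p.totalDegree p

/-- The semialgebraic set `K` defined by the equations `c_i = 0` (`i ∈ E`) and the inequalities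
`c_j ≥ 0` (`j ∈ I`). -/
def semialgSet {n : ℕ} {E I : Type*} (ceq : E → MvPolynomial (Fin n) ℝ)
    (cin : I → MvPolynomial (Fin n) ℝ) : Set (Fin n → ℝ) :=
  {x | (∀ i, MvPolynomial.eval x (ceq i) = 0) ∧ ∀ j, 0 ≤ MvPolynomial.eval x (cin j)}

/-- The set `K̃` of the points `(x₀, x)` of the unit sphere of `ℝ^{n+1}` at which `c̃_i = 0`
(`i ∈ E`), `c̃_j ≥ 0` (`j ∈ I`) and `x₀ ≥ 0`. -/
def homSet {n : ℕ} {E I : Type*} (ceq : E → MvPolynomial (Fin n) ℝ)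
    (cin : I → MvPolynomial (Fin n) ℝ) : Set (Fin (n + 1) → ℝ) :=
  {z | ((∀ i, MvPolynomial.eval z (hom (ceq i)) = 0) ∧
      (∀ j, 0 ≤ MvPolynomial.eval z (hom (cin j))) ∧ 0 ≤ z 0) ∧ ∑ k, z k ^ 2 = 1}

/-- The solutions `y ∈ R_A(K)` of `⟨a_i, y⟩ = b_i` for the first `m₁` indices and
`⟨a_i, y⟩ ≥ b_i` for the remaining ones (`Fin m` counts from `0`). -/
def feasible {N m : ℕ} (m₁ : ℕ) (A : Finset (Fin N →₀ ℕ)) (K : Set (Fin N → ℝ))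
    (a : Fin m → MvPolynomial (Fin N) ℝ) (b : Fin m → ℝ) : Set (A → ℝ) :=
  {y | (∀ i : Fin m, (i : ℕ) < m₁ → pairing (a i) y = b i) ∧
    (∀ i : Fin m, m₁ ≤ (i : ℕ) → b i ≤ pairing (a i) y) ∧ y ∈ momentCone A K}

/-- The feasible `θ` of the dual problem: `f - ∑ θ_i a_i ∈ P_A(K)`, with `θ_i ≥ 0` for the
inequality constraints. -/
def dualFeasible {N m : ℕ} (m₁ : ℕ) (A : Finset (Fin N →₀ ℕ)) (K : Set (Fin N → ℝ))
    (a : Fin m → MvPolynomial (Fin N) ℝ) (f : MvPolynomial (Fin N) ℝ) : Set (Fin m → ℝ) :=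
  {θ | f - ∑ i, MvPolynomial.C (θ i) * a i ∈ nonnegCone A K ∧
    ∀ i : Fin m, m₁ ≤ (i : ℕ) → 0 ≤ θ i}

/-- `w` minimizes `⟨f, w⟩` over the set `S`. -/
def IsMinimizer {N : ℕ} {A : Finset (Fin N →₀ ℕ)} (f : MvPolynomial (Fin N) ℝ)
    (S : Set (A → ℝ)) (w : A → ℝ) : Prop :=
  w ∈ S ∧ ∀ w' ∈ S, pairing f w ≤ pairing f w'

/-- The measure `μ` is `r`-atomic: its support consists of `r` distinct points. -/
def HasAtomCount {N : ℕ} (r : ℕ) (μ : Measure (Fin N → ℝ)) : Prop := μ.support.encard = r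

end GTMP

end

open GTMP

/-!
Both parts rest on the description of the moment cone `R_k(K̃)` as the convex cone generated by the
monomial vectors `[z]_k`, `z ∈ K̃` (`GTMP.momentCone_eq_hull`). The inclusion of the moment cone in
the generated cone is the theorem of Tchakaloff and Bayer–Teichmann: an integral of a function with
values in a convex cone of a finite-dimensional space, closed or not, lies in that cone
(`PointedCone.integral_mem`, by induction on the dimension and weak separation). It is needed
without any compactness or finiteness for the measures on `K`: a feasible `y ∈ R_A(K)` is thereby a
conic combination of monomial vectors of points of `K`, and rescaling the points `(1, x)` to the
unit sphere gives a feasible `w ∈ R_{d₁}(K̃)`.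

Since `K̃` is compact and the constant monomial is `1` on it, the generated cone has compact
slices. An `f` in the interior of the cone of sums of squares is bounded below by some `ε > 0`, so
the sublevel sets of `⟨f, ·⟩` on the cone are compact too. Hence the minimum is attained, and the
epigraph cone of the value function is closed; separating from it a point below the optimal value
gives strong duality (`conicProgramming_strong_duality`).

The minimizer is unique for almost every `f`, whatever the feasible set is: over a bounded set of
`w`, the value is a Lipschitz function of `f`, so by Rademacher's theorem it is differentiable almost
everywhere, and where it is differentiable each minimizer is its derivative
(`ae_subsingleton_minimizers`). The boundary of the convex cone of sums of squares is a null set.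

The bound on the support of a representing measure `μ` of a unique minimizer `w` needs no further
genericity (`GTMP.encard_support_le_of_extreme`). If a polynomial `g` is orthogonal in `L²(μ)` to
all `â_i`, then the measures `(1 ± c g) μ` with small `c > 0` have feasible moments. Neither
lowers the objective, and their mean is optimal, so both are optimal; by uniqueness their moments
are those of `μ`, and `g` is orthogonal to every polynomial of degree at most `d₁`. Therefore each
polynomial of degree at most `d₁` agrees on `supp μ` with a linear combination of the `â_i`. As the
`â_i` have degree at most `d < d₁`, multiplying by one variable at a time shows the same for all
polynomials. Polynomials take arbitrary values on finite sets, so `supp μ` has at most `m` points.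
-/

open Filter Topology

/-! ### Convex cones in finite dimension -/

/-- By Carathéodory's theorem the convex hull is a finite union of images of the compact sets
`stdSimplex ℝ (Fin k) ×ˢ s ^ k`. -/
theorem isCompact_convexHull {E : Type*} [NormedAddCommGroup E] [NormedSpace ℝ E]
    [FiniteDimensional ℝ E] {s : Set E} (hs : IsCompact s) : IsCompact (convexHull ℝ s) := by
  have hU : convexHull ℝ s = ⋃ k ∈ Finset.range (Module.finrank ℝ E + 2),
      (fun p : (Fin k → ℝ) × (Fin k → E) => ∑ i, p.1 i • p.2 i) ''
        (stdSimplex ℝ (Fin k) ×ˢ Set.univ.pi fun _ => s) := by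
    ext x
    simp only [Set.mem_iUnion, Set.mem_image, Prod.exists, Set.mem_prod, exists_prop]
    constructor
    · intro hx
      obtain ⟨ι, _, z, w, hz, hi, hw, hw1, rfl⟩ := eq_pos_convex_span_of_mem_convexHull hx
      let e := Fintype.equivFin ι
      refine ⟨Fintype.card ι, ?_, w ∘ e.symm, z ∘ e.symm, ⟨⟨fun i => (hw _).le, ?_⟩, ?_⟩, ?_⟩
      · have h1 := hi.card_le_finrank_succ
        have h2 := Submodule.finrank_le (vectorSpan ℝ (Set.range z))
        exact Finset.mem_range.2 (by omega)
      · rw [← hw1]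
        exact e.symm.sum_comp w
      · exact fun i _ => hz ⟨_, rfl⟩
      · exact e.symm.sum_comp fun i => w i • z i
    · rintro ⟨k, -, w, z, ⟨hw, hz⟩, rfl⟩
      exact (convex_convexHull ℝ s).sum_mem (fun i _ => hw.1 i) hw.2
        fun i _ => subset_convexHull ℝ s (hz i trivial)
  rw [hU]
  refine Finset.isCompact_biUnion _ fun k _ => ?_
  exact ((isCompact_stdSimplex ℝ (Fin k)).prod (isCompact_univ_pi fun _ => hs)).image
    (by fun_prop)

/-- Weak separation of a point from a convex cone that need not be closed. The functional is
nonzero; if the cone spans a proper subspace, it vanishes on the cone and its sign at `x` is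
not controlled. -/
theorem exists_weak_separation {E : Type*} [NormedAddCommGroup E] [NormedSpace ℝ E]
    [FiniteDimensional ℝ E] (C : PointedCone ℝ E) {x : E} (hx : x ∉ C) :
    ∃ l : StrongDual ℝ E, l ≠ 0 ∧ (∀ c ∈ C, 0 ≤ l c) ∧ (l x ≤ 0 ∨ ∀ c ∈ C, l c = 0) := by
  by_cases hW : Submodule.span ℝ (C : Set E) = ⊤
  · have haff : affineSpan ℝ (C : Set E) = ⊤ := by
      rw [AffineSubspace.affineSpan_eq_top_iff_vectorSpan_eq_top_of_nonempty ℝ E E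
          ⟨0, C.zero_mem⟩, ← hW, vectorSpan_eq_span_vsub_set_right ℝ C.zero_mem]
      simp
    have hne := (C.convex.interior_nonempty_iff_affineSpan_eq_top).2 haff
    obtain ⟨f, hf⟩ := geometric_hahn_banach_open_point C.convex.interior isOpen_interior
      (fun h => hx (interior_subset h))
    have hle : ∀ c ∈ C, f c ≤ f x := by
      intro c hc
      have : (C : Set E) ⊆ {y | f y ≤ f x} := by
        refine subset_closure.trans ?_
        rw [← C.convex.closure_interior_eq_closure_of_nonempty_interior hne]
        exact closure_minimal (fun y hy => (hf y hy).le) (isClosed_le f.continuous continuous_const)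
      exact this hc
    have h0 : 0 ≤ f x := by simpa using hle 0 C.zero_mem
    refine ⟨-f, ?_, fun c hc => ?_, Or.inl (by simpa using h0)⟩
    · rintro h
      obtain ⟨y, hy⟩ := hne
      have := hf y hy
      rw [neg_eq_zero.1 h] at this
      simp at this
    · -- a linear functional bounded above on a cone is nonpositive there
      by_contra! hlt
      have hc' : 0 < f c := by simpa using hlt
      have := hle _ (C.smul_mem (r := (f x + 1) / f c) (by positivity) hc)
      rw [map_smul, smul_eq_mul, div_mul_cancel₀ _ hc'.ne'] at this
      linarith
  · obtain ⟨l, hl, hle⟩ := Submodule.exists_le_ker_of_lt_top _ (lt_top_iff_ne_top.2 hW)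
    have h0 : ∀ c ∈ C, l.toContinuousLinearMap c = 0 := fun c hc => hle (Submodule.subset_span hc)
    refine ⟨l.toContinuousLinearMap, by simpa using hl, fun c hc => (h0 c hc).ge, Or.inr h0⟩

/-- The integral of a function with values in a convex cone lies in the cone. The cone need not
be closed and the measure need not be finite. If the integral were outside, a weakly separating
functional would vanish almost everywhere along `φ`, which reduces the dimension. -/
theorem PointedCone.integral_mem {Ω : Type*} [MeasurableSpace Ω] {μ : Measure Ω} {E : Type*}
    [NormedAddCommGroup E] [NormedSpace ℝ E] [FiniteDimensional ℝ E] (C : PointedCone ℝ E)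
    {φ : Ω → E} (hφ : Integrable φ μ) (hC : ∀ᵐ ω ∂μ, φ ω ∈ C) : ∫ ω, φ ω ∂μ ∈ C := by
  induction hn : Module.finrank ℝ E using Nat.strong_induction_on generalizing E with
  | _ n ih =>
  by_contra hx
  obtain ⟨l, hl, hlC, hl'⟩ := exists_weak_separation C hx
  have hint : ∫ ω, l (φ ω) ∂μ = l (∫ ω, φ ω ∂μ) := l.integral_comp_comm hφ
  have hzero : ∀ᵐ ω ∂μ, l (φ ω) = 0 := by
    rcases hl' with hl' | hl'
    · have h0 : ∀ᵐ ω ∂μ, 0 ≤ l (φ ω) := hC.mono fun ω h => hlC _ h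
      have := (integral_eq_zero_iff_of_nonneg_ae h0 (l.integrable_comp hφ)).1
        (le_antisymm (hint ▸ hl') (integral_nonneg_of_ae h0))
      exact this
    · exact hC.mono fun ω h => hl' _ h
  let W : Submodule ℝ E := LinearMap.ker (l : E →ₗ[ℝ] ℝ)
  have hWlt : Module.finrank ℝ W < Module.finrank ℝ E := by
    refine Submodule.finrank_lt fun h => hl ?_
    ext y
    have : y ∈ W := h ▸ Submodule.mem_top
    exact this
  obtain ⟨P, hP⟩ := W.subtype.exists_leftInverse_of_injective (Submodule.ker_subtype W)
  have hPW : ∀ y : W, P y = y := fun y => LinearMap.congr_fun hP y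
  have hPφ : ∀ᵐ ω ∂μ, ((P.toContinuousLinearMap (φ ω) : W) : E) = φ ω := by
    filter_upwards [hzero] with ω h
    exact congrArg Subtype.val (hPW ⟨φ ω, h⟩)
  have hi := P.toContinuousLinearMap.integrable_comp hφ
  have key := ih _ (hn ▸ hWlt) (PointedCone.comap W.subtype C) hi
    (by filter_upwards [hPφ, hC] with ω h1 h2; rw [← h1] at h2; exact h2) rfl
  rw [PointedCone.mem_comap] at key
  apply hx
  rw [← integral_congr_ae hPφ]
  have := W.subtypeL.integral_comp_comm hi
  simp only [Submodule.subtypeL_apply] at this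
  rw [this]
  exact key

/-! ### Cones over a compact base -/

section ConeOverBase

variable {E : Type*} [NormedAddCommGroup E] [NormedSpace ℝ E]

theorem PointedCone.exists_smul_convexHull {s : Set E} {w : E} (hw : w ∈ PointedCone.hull ℝ s) :
    w = 0 ∨ ∃ t : ℝ, 0 < t ∧ ∃ u ∈ convexHull ℝ s, t • u = w := by
  induction hw using Submodule.span_induction with
  | mem x hx => exact Or.inr ⟨1, one_pos, x, subset_convexHull ℝ s hx, one_smul ℝ x⟩
  | zero => exact Or.inl rfl
  | add x y _ _ hx hy =>
    rcases hx with rfl | ⟨t, ht, u, hu, rfl⟩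
    · simpa using hy
    rcases hy with rfl | ⟨t', ht', u', hu', rfl⟩
    · exact Or.inr ⟨t, ht, u, hu, by simp⟩
    refine Or.inr ⟨t + t', by positivity, (t / (t + t')) • u + (t' / (t + t')) • u',
      convex_iff_div.1 (convex_convexHull ℝ s) hu hu' ht.le ht'.le (by positivity), ?_⟩
    have : t + t' ≠ 0 := by positivity
    simp only [smul_add, smul_smul]
    congr 2 <;> field_simp
  | smul c x _ hx =>
    rcases hx with rfl | ⟨t, ht, u, hu, rfl⟩
    · simp
    rcases eq_or_ne c 0 with rfl | hc
    · simp
    have hc' : 0 < (c : ℝ) := NNReal.coe_pos.2 (pos_iff_ne_zero.2 hc)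
    exact Or.inr ⟨c * t, by positivity, u, hu, mul_smul _ _ _⟩

variable [FiniteDimensional ℝ E] {s : Set E}

theorem PointedCone.isCompact_hull_slice (hs : IsCompact s) (e : StrongDual ℝ E)
    (he : ∀ x ∈ s, e x = 1) (R : ℝ) : IsCompact {w | w ∈ PointedCone.hull ℝ s ∧ e w ≤ R} := by
  have he' : ∀ x ∈ convexHull ℝ s, e x = 1 :=
    convexHull_min he ((convex_singleton (1 : ℝ)).linear_preimage e.toLinearMap)
  have : {w | w ∈ PointedCone.hull ℝ s ∧ e w ≤ R} = ({0} ∩ {w | e w ≤ R}) ∪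
      (fun p : ℝ × E => p.1 • p.2) '' (Set.Icc 0 R ×ˢ convexHull ℝ s) := by
    ext w
    constructor
    · rintro ⟨hw, hR⟩
      rcases PointedCone.exists_smul_convexHull hw with rfl | ⟨t, ht, u, hu, rfl⟩
      · exact Or.inl ⟨rfl, hR⟩
      · rw [map_smul, he' u hu, smul_eq_mul, mul_one] at hR
        exact Or.inr ⟨(t, u), ⟨⟨ht.le, hR⟩, hu⟩, rfl⟩
    · rintro (⟨rfl, hR⟩ | ⟨⟨t, u⟩, ⟨⟨ht, hR⟩, hu⟩, rfl⟩)
      · exact ⟨Submodule.zero_mem _, hR⟩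
      · refine ⟨PointedCone.smul_mem _ ht ?_, ?_⟩
        · exact convexHull_min PointedCone.subset_hull (PointedCone.convex _) hu
        · simpa [he' u hu] using hR
  rw [this]
  refine ((Set.finite_singleton (0 : E)).subset Set.inter_subset_left).isCompact.union ?_
  exact (isCompact_Icc.prod (isCompact_convexHull hs)).image (by fun_prop)

theorem PointedCone.isClosed_hull (hs : IsCompact s) (e : StrongDual ℝ E)
    (he : ∀ x ∈ s, e x = 1) : IsClosed (PointedCone.hull ℝ s : Set E) := by
  refine isClosed_of_closure_subset fun w hw => ?_
  have hU : IsOpen {x | e x < e w + 1} := isOpen_lt e.continuous continuous_const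
  have h1 := hU.inter_closure ⟨show e w < e w + 1 by linarith, hw⟩
  have h2 := closure_minimal (t := {x | x ∈ PointedCone.hull ℝ s ∧ e x ≤ e w + 1})
    (fun x hx => ⟨hx.2, le_of_lt hx.1⟩) (PointedCone.isCompact_hull_slice hs e he _).isClosed h1
  exact h2.1

theorem PointedCone.isCompact_hull_sublevel (hs : IsCompact s) (e : StrongDual ℝ E)
    (he : ∀ x ∈ s, e x = 1) (f : StrongDual ℝ E) {ε : ℝ} (hε : 0 < ε) (hf : ∀ x ∈ s, ε ≤ f x)
    (c : ℝ) : IsCompact {w | w ∈ PointedCone.hull ℝ s ∧ f w ≤ c} := by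
  have hle : ∀ w ∈ PointedCone.hull ℝ s, ε * e w ≤ f w := by
    intro w hw
    induction hw using Submodule.span_induction with
    | mem x hx => rw [he x hx, mul_one]; exact hf x hx
    | zero => simp
    | add x y _ _ hx hy => rw [map_add, map_add]; linarith
    | smul t x _ hx =>
      have h1 : e (t • x) = t * e x := e.map_smul (t : ℝ) x
      have h2 : f (t • x) = t * f x := f.map_smul (t : ℝ) x
      rw [h1, h2]
      rw [mul_left_comm]
      exact mul_le_mul_of_nonneg_left hx t.2
  refine (PointedCone.isCompact_hull_slice hs e he (c / ε)).of_isClosed_subset ?_ ?_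
  · exact (PointedCone.isClosed_hull hs e he).inter (isClosed_le f.continuous continuous_const)
  · rintro w ⟨hw, hc⟩
    exact ⟨hw, by rw [le_div_iff₀ hε, mul_comm]; exact (hle w hw).trans hc⟩

end ConeOverBase

/-! ### Strong duality in conic programming -/

section ConicProgramming

variable {E : Type*} [NormedAddCommGroup E] [NormedSpace ℝ E] {m : ℕ}

/-- The feasible points `w ∈ C` of a conic linear program: the constraint functional `a i` takes
the value `b i` if `P i` holds and a value at least `b i` otherwise. -/
def conicFeasible (C : PointedCone ℝ E) (P : Fin m → Prop) (a : Fin m → StrongDual ℝ E)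
    (b : Fin m → ℝ) : Set E :=
  {w | w ∈ C ∧ (∀ i, P i → a i w = b i) ∧ ∀ i, ¬ P i → b i ≤ a i w}

/-- The epigraph cone of the value function of a conic program: the pairs `(r, u)` such that the
program with right-hand side `u` has a feasible point of objective value at most `r`. -/
def valueEpigraph (C : PointedCone ℝ E) (P : Fin m → Prop) (a : Fin m → StrongDual ℝ E)
    (f : StrongDual ℝ E) : PointedCone ℝ (ℝ × (Fin m → ℝ)) where
  carrier := {p | ∃ w ∈ conicFeasible C P a p.2, f w ≤ p.1}
  zero_mem' := ⟨0, ⟨C.zero_mem, by simp, by simp⟩, by simp⟩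
  add_mem' := by
    rintro p q ⟨w, ⟨hw, h1, h2⟩, hf⟩ ⟨w', ⟨hw', h1', h2'⟩, hf'⟩
    refine ⟨w + w', ⟨C.add_mem hw hw', fun i hi => ?_, fun i hi => ?_⟩, ?_⟩
    · simp [h1 i hi, h1' i hi]
    · simpa using add_le_add (h2 i hi) (h2' i hi)
    · simpa using add_le_add hf hf'
  smul_mem' := by
    rintro c p ⟨w, ⟨hw, h1, h2⟩, hf⟩
    refine ⟨c • w, ⟨C.smul_mem c.2 hw, fun i hi => ?_, fun i hi => ?_⟩, ?_⟩
    · have : a i (c • w) = c * a i w := (a i).map_smul (c : ℝ) w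
      rw [this, h1 i hi]; rfl
    · have : a i (c • w) = c * a i w := (a i).map_smul (c : ℝ) w
      rw [this]
      exact mul_le_mul_of_nonneg_left (h2 i hi) c.2
    · have : f (c • w) = c * f w := f.map_smul (c : ℝ) w
      rw [this]
      exact mul_le_mul_of_nonneg_left hf c.2

/-- Along a convergent sequence in the epigraph the objective values are bounded, so the feasible
points stay in a compact sublevel set. -/
theorem isClosed_valueEpigraph (C : PointedCone ℝ E) (P : Fin m → Prop)
    (a : Fin m → StrongDual ℝ E) (f : StrongDual ℝ E)
    (hC : ∀ c, IsCompact {w | w ∈ C ∧ f w ≤ c}) :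
    IsClosed (valueEpigraph C P a f : Set (ℝ × (Fin m → ℝ))) := by
  refine IsSeqClosed.isClosed fun p q hp hq => ?_
  choose w hw hf using hp
  have hq1 : Tendsto (fun k => (p k).1) atTop (𝓝 q.1) := (continuous_fst.tendsto q).comp hq
  have hq2 : ∀ i, Tendsto (fun k => (p k).2 i) atTop (𝓝 (q.2 i)) := fun i =>
    (((continuous_apply i).comp continuous_snd).tendsto q).comp hq
  obtain ⟨R, hR⟩ := hq1.bddAbove_range
  obtain ⟨v, hv, φ, hφ, hlim⟩ := (hC R).tendsto_subseq
    (x := w) fun k => ⟨(hw k).1, (hf k).trans (hR ⟨k, rfl⟩)⟩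
  have hl : ∀ g : StrongDual ℝ E, Tendsto (fun k => g (w (φ k))) atTop (𝓝 (g v)) := fun g =>
    (g.continuous.tendsto v).comp hlim
  refine ⟨v, ⟨hv.1, fun i hi => ?_, fun i hi => ?_⟩, ?_⟩
  · refine tendsto_nhds_unique (hl (a i)) ?_
    exact ((hq2 i).comp hφ.tendsto_atTop).congr fun k => ((hw (φ k)).2.1 i hi).symm
  · exact le_of_tendsto_of_tendsto' ((hq2 i).comp hφ.tendsto_atTop) (hl (a i))
      fun k => (hw (φ k)).2.2 i hi
  · exact le_of_tendsto_of_tendsto' (hl f) (hq1.comp hφ.tendsto_atTop) fun k => hf (φ k)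

theorem exists_isLeast_conicFeasible (C : PointedCone ℝ E) (P : Fin m → Prop)
    (a : Fin m → StrongDual ℝ E) (b : Fin m → ℝ) (f : StrongDual ℝ E)
    (hC : ∀ c, IsCompact {w | w ∈ C ∧ f w ≤ c}) (hne : (conicFeasible C P a b).Nonempty) :
    ∃ v, IsLeast (f '' conicFeasible C P a b) v := by
  obtain ⟨w₀, hw₀⟩ := hne
  have hcl : IsClosed {w | (∀ i, P i → a i w = b i) ∧ ∀ i, ¬ P i → b i ≤ a i w} := by
    simp only [Set.ofPred_and, Set.ofPred_forall]
    refine IsClosed.inter ?_ ?_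
    · exact isClosed_iInter fun i => isClosed_iInter fun _ =>
        isClosed_eq (a i).continuous continuous_const
    · exact isClosed_iInter fun i => isClosed_iInter fun _ =>
        isClosed_le continuous_const (a i).continuous
  obtain ⟨w, ⟨⟨hw, hfw⟩, hw'⟩, hmin⟩ := ((hC (f w₀)).inter_right hcl).exists_isMinOn
    ⟨w₀, ⟨hw₀.1, le_rfl⟩, hw₀.2⟩ f.continuous.continuousOn
  refine ⟨f w, ⟨w, ⟨hw, hw'⟩, rfl⟩, ?_⟩
  rintro _ ⟨w', h', rfl⟩
  rcases le_total (f w') (f w₀) with h | h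
  · exact hmin ⟨⟨h'.1, h⟩, h'.2⟩
  · exact hfw.trans h

/-- Attainment and strong duality when the sublevel sets of the objective on the cone are compact;
no interior point of the primal constraints is required. -/
theorem conicProgramming_strong_duality (C : PointedCone ℝ E) (P : Fin m → Prop)
    (a : Fin m → StrongDual ℝ E) (b : Fin m → ℝ) (f : StrongDual ℝ E)
    (hC : ∀ c, IsCompact {w | w ∈ C ∧ f w ≤ c}) (hne : (conicFeasible C P a b).Nonempty) :
    ∃ v, IsLeast (f '' conicFeasible C P a b) v ∧
      IsLUB ((fun θ : Fin m → ℝ => ∑ i, b i * θ i) ''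
        {θ | (∀ w ∈ C, ∑ i, θ i * a i w ≤ f w) ∧ ∀ i, ¬ P i → 0 ≤ θ i}) v := by
  obtain ⟨v, hv⟩ := exists_isLeast_conicFeasible C P a b f hC hne
  -- multipliers of the correct sign increase along feasible points
  have hmono : ∀ θ : Fin m → ℝ, (∀ i, ¬ P i → 0 ≤ θ i) → ∀ w ∈ conicFeasible C P a b,
      ∑ i, b i * θ i ≤ ∑ i, θ i * a i w := by
    intro θ hθ w hw
    refine Finset.sum_le_sum fun i _ => ?_
    by_cases hi : P i
    · rw [hw.2.1 i hi, mul_comm]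
    · rw [mul_comm]
      exact mul_le_mul_of_nonneg_left (hw.2.2 i hi) (hθ i hi)
  refine ⟨v, hv, ?_, ?_⟩
  · rintro _ ⟨θ, ⟨hθ, hθ'⟩, rfl⟩
    obtain ⟨⟨w, hw, rfl⟩, -⟩ := hv
    exact (hmono θ hθ' w hw).trans (hθ w hw.1)
  · intro B hB
    refine le_of_forall_lt fun r hr => ?_
    let D : ProperCone ℝ (ℝ × (Fin m → ℝ)) :=
      { valueEpigraph C P a f with isClosed' := isClosed_valueEpigraph C P a f hC }
    have hD : ∀ p, p ∈ D ↔ ∃ w ∈ conicFeasible C P a p.2, f w ≤ p.1 := fun p => Iff.rfl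
    have hnot : (r, b) ∉ D := by
      rw [hD]
      rintro ⟨w, hw, hfw⟩
      exact absurd (hv.2 ⟨w, hw, rfl⟩) (not_le.2 (hfw.trans_lt hr))
    obtain ⟨l, hl, hlt⟩ := D.hyperplane_separation_point hnot
    set θ : Fin m → ℝ := fun i => -l (0, Pi.single i 1) with hθdef
    set t : ℝ := l (1, 0) with ht
    have hform : ∀ s u, l (s, u) = t * s - ∑ i, θ i * u i := by
      intro s u
      have h1 : (s, u) = s • ((1 : ℝ), (0 : Fin m → ℝ)) +
          ∑ i, u i • ((0 : ℝ), (Pi.single i 1 : Fin m → ℝ)) := by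
        refine Prod.ext ?_ ?_
        · simp [Prod.fst_sum]
        · funext j
          simp [Prod.snd_sum, Finset.sum_apply, Pi.single_apply]
      rw [h1, map_add, map_smul, map_sum]
      simp only [map_smul, smul_eq_mul, hθdef, neg_mul, Finset.sum_neg_distrib, sub_neg_eq_add]
      rw [mul_comm s, ← ht]
      congr 1
      exact Finset.sum_congr rfl fun i _ => mul_comm _ _
    have ht0 : 0 ≤ t := hl _ ((hD _).2 ⟨0, ⟨C.zero_mem, by simp, by simp⟩, by simp⟩)
    have hθ0 : ∀ i, ¬ P i → 0 ≤ θ i := by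
      intro i hi
      have h := hl (0, -Pi.single i 1) ((hD _).2 ⟨0, ⟨C.zero_mem, fun j hj => ?_, fun j _ => ?_⟩,
        by simp⟩)
      · rw [hform] at h
        simpa [Pi.single_apply] using h
      · have : j ≠ i := by rintro rfl; exact hi hj
        simp [this]
      · rcases eq_or_ne j i with rfl | hji <;> simp [*]
    have hdual : ∀ w ∈ C, ∑ i, θ i * a i w ≤ t * f w := by
      intro w hw
      have h := hl (f w, fun i => a i w) ((hD _).2 ⟨w, ⟨hw, fun _ _ => rfl, fun _ _ => le_rfl⟩,
        le_rfl⟩)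
      rw [hform] at h
      linarith
    rw [hform] at hlt
    -- if `t = 0`, then `θ` would separate the constraints at a feasible point
    have htpos : 0 < t := by
      refine lt_of_le_of_ne ht0 fun h0 => ?_
      obtain ⟨w, hw⟩ := hne
      have h1 := hmono θ hθ0 w hw
      have h2 := hdual w hw.1
      rw [← h0] at h2 hlt
      have h3 : ∑ i, b i * θ i = ∑ i, θ i * b i := Finset.sum_congr rfl fun i _ => mul_comm _ _
      linarith
    have hmem := hB ⟨fun i => θ i / t, ⟨fun w hw => ?_, fun i hi => div_nonneg (hθ0 i hi) ht0⟩,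
      rfl⟩
    · refine lt_of_lt_of_le ?_ hmem
      have : ∑ i, b i * (θ i / t) = (∑ i, θ i * b i) / t := by
        rw [Finset.sum_div]
        exact Finset.sum_congr rfl fun i _ => by ring
      simp only [this]
      rw [lt_div_iff₀ htpos]
      linarith
    · have : ∑ i, θ i / t * a i w = (∑ i, θ i * a i w) / t := by
        rw [Finset.sum_div]
        exact Finset.sum_congr rfl fun i _ => by ring
      rw [this, div_le_iff₀ htpos, mul_comm]
      exact hdual w hw

end ConicProgramming

/-! ### Generic uniqueness of minimizers of linear functions -/

section GenericUniqueness

variable {V : Type*} [NormedAddCommGroup V] [NormedSpace ℝ V] [FiniteDimensional ℝ V]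
  [MeasurableSpace V] [BorelSpace V] (ν : Measure V) [ν.IsAddHaarMeasure]

/-- The points of `V` are the objectives, the elements of `F` the feasible points, acting on
objectives by evaluation. -/
theorem ae_subsingleton_minimizers_of_bounded {F : Set (StrongDual ℝ V)} {R : ℝ}
    (hR : ∀ w ∈ F, ‖w‖ ≤ R) :
    ∀ᵐ x ∂ν, {w | w ∈ F ∧ ∀ w' ∈ F, w x ≤ w' x}.Subsingleton := by
  rcases F.eq_empty_or_nonempty with rfl | hF
  · simp
  have hR0 : 0 ≤ R := (norm_nonneg _).trans (hR _ hF.some_mem)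
  let v : V → ℝ := fun x => sInf ((fun w : StrongDual ℝ V => w x) '' F)
  have hbdd : ∀ x, BddBelow ((fun w : StrongDual ℝ V => w x) '' F) := by
    intro x
    refine ⟨-(R * ‖x‖), ?_⟩
    rintro _ ⟨w, hw, rfl⟩
    have h1 := w.le_opNorm x
    have h2 := mul_le_mul_of_nonneg_right (hR w hw) (norm_nonneg x)
    exact neg_le_of_abs_le (h1.trans h2)
  have hv : ∀ x, ∀ w ∈ F, v x ≤ w x := fun x w hw => csInf_le (hbdd x) ⟨w, hw, rfl⟩
  have hlip : LipschitzWith R.toNNReal v := by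
    refine LipschitzWith.of_le_add_mul _ fun x y => ?_
    rw [Real.coe_toNNReal R hR0, ← sub_le_iff_le_add]
    refine le_csInf (hF.image _) ?_
    rintro _ ⟨w, hw, rfl⟩
    have h1 := (le_abs_self _).trans (w.le_opNorm (x - y))
    have h2 := mul_le_mul_of_nonneg_right (hR w hw) (norm_nonneg (x - y))
    rw [map_sub] at h1
    have h3 := hv x w hw
    rw [dist_eq_norm]
    simp only
    linarith
  filter_upwards [hlip.ae_differentiableAt (μ := ν)] with x hx
  -- a minimizer at `x` is a supergradient of `v` at `x`, hence its derivative
  have key : ∀ w, w ∈ F → (∀ w' ∈ F, w x ≤ w' x) → w = fderiv ℝ v x := by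
    intro w hw hmin
    have hvx : v x = w x := by
      refine le_antisymm (hv x w hw) (le_csInf (hF.image _) ?_)
      rintro _ ⟨w', hw', rfl⟩
      exact hmin w' hw'
    have hloc : IsLocalMin (fun y => w y - v y) x := by
      refine Eventually.of_forall fun y => ?_
      simp only [hvx, sub_self, sub_nonneg]
      exact hv y w hw
    exact sub_eq_zero.1 (hloc.hasFDerivAt_eq_zero (w.hasFDerivAt.sub hx.hasFDerivAt))
  intro w hw w' hw'
  rw [key w hw.1 hw.2, key w' hw'.1 hw'.2]

theorem ae_subsingleton_minimizers (F : Set (StrongDual ℝ V)) :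
    ∀ᵐ x ∂ν, {w | w ∈ F ∧ ∀ w' ∈ F, w x ≤ w' x}.Subsingleton := by
  have h : ∀ᵐ x ∂ν, ∀ N : ℕ, {w | w ∈ {u ∈ F | ‖u‖ ≤ N} ∧
      ∀ w' ∈ {u ∈ F | ‖u‖ ≤ N}, w x ≤ w' x}.Subsingleton :=
    ae_all_iff.2 fun N => ae_subsingleton_minimizers_of_bounded ν fun w hw => hw.2
  filter_upwards [h] with x hx w hw w' hw'
  obtain ⟨N, hN⟩ := exists_nat_ge (max ‖w‖ ‖w'‖)
  exact hx N ⟨⟨hw.1, (le_max_left _ _).trans hN⟩, fun u hu => hw.2 u hu.1⟩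
    ⟨⟨hw'.1, (le_max_right _ _).trans hN⟩, fun u hu => hw'.2 u hu.1⟩

end GenericUniqueness

namespace GTMP

/-! ### The moment cone as the cone of monomial vectors -/

variable {N : ℕ} {A : Finset (Fin N →₀ ℕ)}

/-- The vector `[x]_A` of the monomials `x^α`, `α ∈ A`, at the point `x`. -/
def monomialVector (A : Finset (Fin N →₀ ℕ)) (x : Fin N → ℝ) : A → ℝ :=
  fun α => ∏ i, x i ^ (α : Fin N →₀ ℕ) i

@[fun_prop]
theorem continuous_monomialVector : Continuous (monomialVector A) := by
  unfold monomialVector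
  fun_prop

theorem ofCoeffs_mem (c : A → ℝ) :
    ofCoeffs c ∈ MvPolynomial.restrictSupport ℝ (A : Set (Fin N →₀ ℕ)) :=
  Submodule.sum_mem _ fun α _ => (MvPolynomial.monomial_mem_restrictSupport ℝ).2 (Or.inl α.2)

theorem coeff_ofCoeffs (c : A → ℝ) (α : A) : (ofCoeffs c).coeff (α : Fin N →₀ ℕ) = c α := by
  classical
  simp [ofCoeffs, MvPolynomial.coeff_sum, MvPolynomial.coeff_monomial]

theorem ofCoeffs_add (c c' : A → ℝ) : ofCoeffs (c + c') = ofCoeffs c + ofCoeffs c' := by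
  simp [ofCoeffs, Finset.sum_add_distrib]

theorem ofCoeffs_smul (t : ℝ) (c : A → ℝ) : ofCoeffs (t • c) = MvPolynomial.C t * ofCoeffs c := by
  simp [ofCoeffs, Finset.mul_sum, MvPolynomial.C_mul_monomial]

/-- The pairing `⟨p, ·⟩` as a continuous linear functional on `ℝ^A`. -/
def pairingCLM (A : Finset (Fin N →₀ ℕ)) (p : MvPolynomial (Fin N) ℝ) : StrongDual ℝ (A → ℝ) :=
  ∑ α : A, p.coeff (α : Fin N →₀ ℕ) • ContinuousLinearMap.proj α

@[simp]
theorem pairingCLM_apply (p : MvPolynomial (Fin N) ℝ) (y : A → ℝ) :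
    pairingCLM A p y = pairing p y := by
  simp [pairingCLM, pairing]

theorem pairing_monomialVector {p : MvPolynomial (Fin N) ℝ}
    (hp : p ∈ MvPolynomial.restrictSupport ℝ (A : Set (Fin N →₀ ℕ))) (x : Fin N → ℝ) :
    pairing p (monomialVector A x) = MvPolynomial.eval x p := by
  rw [MvPolynomial.eval_eq', pairing]
  simp only [monomialVector]
  rw [Finset.sum_coe_sort A fun α => p.coeff α * ∏ i, x i ^ α i]
  refine (Finset.sum_subset ((MvPolynomial.mem_restrictSupport_iff ℝ).1 hp) fun α _ h => ?_).symm
  rw [MvPolynomial.notMem_support_iff.1 h, zero_mul]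

theorem exists_dual_eq_pairing (w : A → ℝ) :
    ∃ l : StrongDual ℝ (A → ℝ), ∀ f, l f = pairing (ofCoeffs f) w :=
  ⟨∑ α : A, w α • ContinuousLinearMap.proj α, fun f => by
    simp [pairing, coeff_ofCoeffs, mul_comm]⟩

theorem momentCone_subset_hull (K : Set (Fin N → ℝ)) :
    momentCone A K ⊆ (PointedCone.hull ℝ (monomialVector A '' K) : Set (A → ℝ)) := by
  rintro y ⟨μ, hμ, hy⟩
  have hint : Integrable (monomialVector A) μ := Integrable.of_eval fun α => (hy α).1
  have : y = ∫ x, monomialVector A x ∂μ := by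
    funext α
    exact (hy α).2.trans (eval_integral (f := monomialVector A) (fun α => (hy α).1) α).symm
  rw [this]
  refine PointedCone.integral_mem _ hint ?_
  filter_upwards [μ.support_mem_ae] with x hx
  exact PointedCone.subset_hull ⟨x, hμ hx, rfl⟩

/-- Conic combinations of Dirac measures represent the points of the generated cone. No closedness
of `K` is needed, since finite sets are closed. -/
theorem hull_subset_momentCone (K : Set (Fin N → ℝ)) :
    (PointedCone.hull ℝ (monomialVector A '' K) : Set (A → ℝ)) ⊆ momentCone A K := by
  intro y hy
  induction hy using Submodule.span_induction with
  | mem y hy =>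
    obtain ⟨x, hx, rfl⟩ := hy
    refine ⟨Measure.dirac x, ?_, fun α => ⟨integrable_dirac (by simp), ?_⟩⟩
    · refine (Measure.support_subset_of_isClosed (isClosed_singleton (x := x)) ?_).trans
        (Set.singleton_subset_iff.2 hx)
      simp
    · rw [integral_dirac]; rfl
  | zero => exact ⟨0, by simp, by simp⟩
  | add y z _ _ hy hz =>
    obtain ⟨μ, hμ, hy⟩ := hy
    obtain ⟨ν, hν, hz⟩ := hz
    refine ⟨μ + ν, ?_, fun α => ⟨(hy α).1.add_measure (hz α).1, ?_⟩⟩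
    · rw [Measure.support_add]
      exact Set.union_subset hμ hν
    · rw [integral_add_measure (hy α).1 (hz α).1, ← (hy α).2, ← (hz α).2]; rfl
  | smul c y _ hy =>
    obtain ⟨μ, hμ, hy⟩ := hy
    let c' : NNReal := c
    refine ⟨c' • μ, ?_, fun α => ⟨(hy α).1.smul_measure_nnreal, ?_⟩⟩
    · exact (Measure.smul_absolutelyContinuous (c := c')).support_mono.trans hμ
    · rw [integral_smul_nnreal_measure, ← (hy α).2]; rfl

theorem momentCone_eq_hull (A : Finset (Fin N →₀ ℕ)) (K : Set (Fin N → ℝ)) :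
    momentCone A K = (PointedCone.hull ℝ (monomialVector A '' K) : Set (A → ℝ)) :=
  (momentCone_subset_hull K).antisymm (hull_subset_momentCone K)

theorem feasible_eq_conicFeasible {m : ℕ} (m₁ : ℕ) (K : Set (Fin N → ℝ))
    (a : Fin m → MvPolynomial (Fin N) ℝ) (b : Fin m → ℝ) :
    feasible m₁ A K a b = conicFeasible (PointedCone.hull ℝ (monomialVector A '' K))
      (fun i => (i : ℕ) < m₁) (fun i => pairingCLM A (a i)) b := by
  ext w
  simp only [feasible, conicFeasible, momentCone_eq_hull, Set.mem_ofPred_eq, SetLike.mem_coe,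
    pairingCLM_apply, not_lt]
  tauto

theorem pairing_nonneg_of_mem_hull {K : Set (Fin N → ℝ)} {p : MvPolynomial (Fin N) ℝ}
    (hp : p ∈ nonnegCone A K) {w : A → ℝ}
    (hw : w ∈ PointedCone.hull ℝ (monomialVector A '' K)) : 0 ≤ pairing p w := by
  rw [← pairingCLM_apply]
  induction hw using Submodule.span_induction with
  | mem y hy =>
    obtain ⟨x, hx, rfl⟩ := hy
    rw [pairingCLM_apply, pairing_monomialVector hp.1]
    exact hp.2 x hx
  | zero => rw [map_zero]
  | add y z _ _ hy hz => rw [map_add]; exact add_nonneg hy hz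
  | smul c y _ hy =>
    have : pairingCLM A p (c • y) = c * pairingCLM A p y := (pairingCLM A p).map_smul (c : ℝ) y
    rw [this]
    exact mul_nonneg c.2 hy

theorem pairing_sub_sum {m : ℕ} (f : MvPolynomial (Fin N) ℝ) (a : Fin m → MvPolynomial (Fin N) ℝ)
    (θ : Fin m → ℝ) (w : A → ℝ) :
    pairing (f - ∑ i, MvPolynomial.C (θ i) * a i) w = pairing f w - ∑ i, θ i * pairing (a i) w := by
  simp only [pairing, MvPolynomial.coeff_sub, MvPolynomial.coeff_sum, MvPolynomial.coeff_C_mul,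
    sub_mul, Finset.sum_sub_distrib, Finset.sum_mul, Finset.mul_sum]
  rw [Finset.sum_comm]
  simp only [mul_assoc]

theorem dualFeasible_eq {m : ℕ} (m₁ : ℕ) (K : Set (Fin N → ℝ))
    {a : Fin m → MvPolynomial (Fin N) ℝ} {f : MvPolynomial (Fin N) ℝ}
    (hf : f ∈ MvPolynomial.restrictSupport ℝ (A : Set (Fin N →₀ ℕ)))
    (ha : ∀ i, a i ∈ MvPolynomial.restrictSupport ℝ (A : Set (Fin N →₀ ℕ))) :
    dualFeasible m₁ A K a f = {θ | (∀ w ∈ PointedCone.hull ℝ (monomialVector A '' K),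
      ∑ i, θ i * pairingCLM A (a i) w ≤ pairingCLM A f w) ∧
      ∀ i : Fin m, ¬ (i : ℕ) < m₁ → 0 ≤ θ i} := by
  ext θ
  simp only [dualFeasible, Set.mem_ofPred_eq, not_lt, pairingCLM_apply]
  refine and_congr_left fun _ => ⟨fun h w hw => ?_, fun h => ⟨?_, fun x hx => ?_⟩⟩
  · have := pairing_nonneg_of_mem_hull h hw
    rw [pairing_sub_sum] at this
    linarith
  · refine Submodule.sub_mem _ hf (Submodule.sum_mem _ fun i _ => ?_)
    rw [← MvPolynomial.smul_eq_C_mul]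
    exact Submodule.smul_mem _ _ (ha i)
  · have := h _ (PointedCone.subset_hull ⟨x, hx, rfl⟩)
    rw [pairing_monomialVector hf] at this
    simp only [pairing_monomialVector (ha _)] at this
    simpa using this

/-! ### Homogenization -/

section Homogenization

variable {n : ℕ}

theorem degree_cons (k : ℕ) (α : Fin n →₀ ℕ) : (Finsupp.cons k α).degree = k + α.degree := by
  simp [Finsupp.degree_eq_sum, Fin.sum_univ_succ]

theorem homogenize_mem {D k : ℕ} (hD : D ≤ k) {p : MvPolynomial (Fin n) ℝ}
    (hp : p.totalDegree ≤ D) :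
    homogenize D p ∈ MvPolynomial.restrictSupport ℝ (powers (n + 1) k : Set (Fin (n + 1) →₀ ℕ)) := by
  refine Submodule.sum_mem _ fun α hα => (MvPolynomial.monomial_mem_restrictSupport ℝ).2 (Or.inl ?_)
  have := (MvPolynomial.le_totalDegree hα).trans hp
  rw [Finset.mem_coe, mem_powers, degree_cons]
  change α.degree ≤ D at this
  omega

theorem eval_homogenize {D : ℕ} {p : MvPolynomial (Fin n) ℝ} (hp : p.totalDegree ≤ D) (s : ℝ)
    (x : Fin n → ℝ) :
    MvPolynomial.eval (s • (Fin.cons 1 x : Fin (n + 1) → ℝ)) (homogenize D p) =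
      s ^ D * MvPolynomial.eval x p := by
  rw [homogenize, map_sum, MvPolynomial.eval_eq', Finset.mul_sum]
  refine Finset.sum_congr rfl fun α hα => ?_
  have h : α.degree ≤ D := (MvPolynomial.le_totalDegree hα).trans hp
  rw [MvPolynomial.eval_monomial, Finsupp.prod_fintype _ _ (by simp), Fin.prod_univ_succ]
  simp only [Pi.smul_apply, Fin.cons_zero, Fin.cons_succ, Finsupp.cons_zero, Finsupp.cons_succ,
    smul_eq_mul, mul_one, mul_pow, Finset.prod_mul_distrib, Finset.prod_pow_eq_pow_sum]
  rw [← Finsupp.degree_eq_sum, ← mul_assoc (s ^ _), ← pow_add, Nat.sub_add_cancel h]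
  ring

theorem isCompact_homSet {E I : Type*} (ceq : E → MvPolynomial (Fin n) ℝ)
    (cin : I → MvPolynomial (Fin n) ℝ) : IsCompact (homSet ceq cin) := by
  refine (isCompact_univ_pi fun _ : Fin (n + 1) => isCompact_Icc (a := (-1 : ℝ))
    (b := 1)).of_isClosed_subset ?_ ?_
  · unfold homSet
    simp only [Set.ofPred_and, Set.ofPred_forall]
    refine ((isClosed_iInter fun i => ?_).inter ((isClosed_iInter fun j => ?_).inter ?_)).inter ?_
    · exact isClosed_eq (MvPolynomial.continuous_eval _) continuous_const
    · exact isClosed_le continuous_const (MvPolynomial.continuous_eval _)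
    · exact isClosed_le continuous_const (continuous_apply 0)
    · exact isClosed_eq (by fun_prop) continuous_const
  · rintro z ⟨-, hz⟩ k -
    have : z k ^ 2 ≤ 1 := hz ▸ Finset.single_le_sum (f := fun k => z k ^ 2)
      (fun i _ => sq_nonneg (z i)) (Finset.mem_univ k)
    exact abs_le.1 (abs_le_one_iff_mul_self_le_one.2 (by rwa [← sq]))

/-- The positive multiple of `(1, x)` on the unit sphere lies in `K̃`. -/
theorem exists_smul_cons_mem_homSet {E I : Type*} {ceq : E → MvPolynomial (Fin n) ℝ}
    {cin : I → MvPolynomial (Fin n) ℝ} {x : Fin n → ℝ} (hx : x ∈ semialgSet ceq cin) :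
    ∃ s : ℝ, 0 < s ∧ s • (Fin.cons 1 x : Fin (n + 1) → ℝ) ∈ homSet ceq cin := by
  have h1 : 0 < 1 + ∑ i, x i ^ 2 :=
    add_pos_of_pos_of_nonneg one_pos (Finset.sum_nonneg fun i _ => sq_nonneg _)
  have hs : 0 < (√(1 + ∑ i, x i ^ 2))⁻¹ := inv_pos.2 (Real.sqrt_pos.2 h1)
  refine ⟨(√(1 + ∑ i, x i ^ 2))⁻¹, hs, ⟨fun i => ?_, fun j => ?_, ?_⟩, ?_⟩
  · rw [hom, eval_homogenize le_rfl, hx.1 i, mul_zero]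
  · rw [hom, eval_homogenize le_rfl]
    exact mul_nonneg (pow_nonneg hs.le _) (hx.2 j)
  · simp
  · simp only [Pi.smul_apply, smul_eq_mul, mul_pow, ← Finset.mul_sum, Fin.sum_univ_succ,
      Fin.cons_zero, Fin.cons_succ, one_pow, inv_pow, Real.sq_sqrt h1.le]
    exact inv_mul_cancel₀ h1.ne'

theorem totalDegree_le_setDegree {A : Finset (Fin n →₀ ℕ)} {p : MvPolynomial (Fin n) ℝ}
    (hp : p ∈ MvPolynomial.restrictSupport ℝ (A : Set (Fin n →₀ ℕ))) :
    p.totalDegree ≤ setDegree A :=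
  Finset.sup_mono (f := fun α : Fin n →₀ ℕ => α.degree) ((MvPolynomial.mem_restrictSupport_iff ℝ).1 hp)

/-- Every atomic moment vector over `K` lifts to one over `K̃` with the same values on the
homogenized polynomials: an atom at `x` moves to `s • (1, x)` and its weight is divided by `s ^ d`. -/
theorem exists_mem_hull_homogenize {E I : Type*} (ceq : E → MvPolynomial (Fin n) ℝ)
    (cin : I → MvPolynomial (Fin n) ℝ) {A : Finset (Fin n →₀ ℕ)} {k : ℕ} (hk : setDegree A ≤ k)
    {y : A → ℝ} (hy : y ∈ PointedCone.hull ℝ (monomialVector A '' semialgSet ceq cin)) :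
    ∃ w ∈ PointedCone.hull ℝ (monomialVector (powers (n + 1) k) '' homSet ceq cin),
      ∀ p ∈ MvPolynomial.restrictSupport ℝ (A : Set (Fin n →₀ ℕ)),
        pairing (homogenize (setDegree A) p) w = pairing p y := by
  simp only [← pairingCLM_apply]
  induction hy using Submodule.span_induction with
  | mem y hy =>
    obtain ⟨x, hx, rfl⟩ := hy
    obtain ⟨s, hs, hz⟩ := exists_smul_cons_mem_homSet hx
    refine ⟨(s ^ setDegree A)⁻¹ • monomialVector _ (s • (Fin.cons 1 x : Fin (n + 1) → ℝ)),
      PointedCone.smul_mem _ (by positivity) (PointedCone.subset_hull ⟨_, hz, rfl⟩),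
      fun p hp => ?_⟩
    have hd := totalDegree_le_setDegree hp
    rw [map_smul, pairingCLM_apply, pairingCLM_apply, pairing_monomialVector hp,
      pairing_monomialVector (homogenize_mem hk hd), eval_homogenize hd, smul_eq_mul,
      inv_mul_cancel_left₀ (by positivity)]
  | zero => exact ⟨0, Submodule.zero_mem _, fun p _ => by rw [map_zero, map_zero]⟩
  | add y z _ _ hy hz =>
    obtain ⟨w, hw, hy⟩ := hy
    obtain ⟨w', hw', hz⟩ := hz
    exact ⟨w + w', Submodule.add_mem _ hw hw', fun p hp => by
      rw [map_add, map_add, hy p hp, hz p hp]⟩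
  | smul c y _ hy =>
    obtain ⟨w, hw, hy⟩ := hy
    refine ⟨c • w, Submodule.smul_mem _ c hw, fun p hp => ?_⟩
    have h1 := (pairingCLM (powers (n + 1) k) (homogenize (setDegree A) p)).map_smul (c : ℝ) w
    have h2 := (pairingCLM A p).map_smul (c : ℝ) y
    rw [hy p hp] at h1
    exact h1.trans h2.symm

end Homogenization

/-! ### Sums of squares -/

section SumsOfSquares

theorem eval_nonneg_of_isSumSq {p : MvPolynomial (Fin N) ℝ} (hp : IsSumSq p) (x : Fin N → ℝ) :
    0 ≤ MvPolynomial.eval x p := by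
  induction hp with
  | zero => simp
  | sq_add a _ ih =>
    rw [map_add, map_mul]
    exact add_nonneg (mul_self_nonneg _) ih

theorem convex_sosCone (k : ℕ) : Convex ℝ (sosCone N k) := by
  have hsmul : ∀ t : ℝ, 0 ≤ t → ∀ c ∈ sosCone N k, t • c ∈ sosCone N k := by
    intro t ht c hc
    change IsSumSq (ofCoeffs (t • c))
    rw [ofCoeffs_smul]
    refine IsSumSq.mul ?_ hc
    rw [← Real.mul_self_sqrt ht, map_mul]
    exact IsSumSq.mul_self _
  intro c hc c' hc' s t hs ht _
  change IsSumSq (ofCoeffs (s • c + t • c'))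
  rw [ofCoeffs_add]
  exact (hsmul s hs c hc).add (hsmul t ht c' hc')

theorem exists_pos_le_eval_of_mem_interior {k : ℕ} {f : powers N k → ℝ}
    (hf : f ∈ interior (sosCone N k)) :
    ∃ ε > 0, ∀ x, ε ≤ MvPolynomial.eval x (ofCoeffs f) := by
  -- subtracting a small constant polynomial from `f` leaves a sum of squares
  let e : powers N k := ⟨0, mem_powers.2 (by simp)⟩
  have hcont : Continuous fun t : ℝ => f + (-t) • Pi.single e (1 : ℝ) := by fun_prop
  have hev : ∀ᶠ t in 𝓝[>] (0 : ℝ), f + (-t) • Pi.single e (1 : ℝ) ∈ sosCone N k := by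
    refine nhdsWithin_le_nhds ((hcont.tendsto 0).eventually ?_)
    rw [neg_zero, zero_smul, add_zero]
    exact mem_interior_iff_mem_nhds.1 hf
  obtain ⟨ε, hε, h0⟩ := (hev.and self_mem_nhdsWithin).exists
  refine ⟨ε, h0, fun x => ?_⟩
  have h := eval_nonneg_of_isSumSq hε x
  have h1 : ofCoeffs (Pi.single e (1 : ℝ)) = (1 : MvPolynomial (Fin N) ℝ) := by
    rw [ofCoeffs, Finset.sum_eq_single e]
    · simp [e]
    · intro α _ hα
      simp [hα]
    · simp
  rw [ofCoeffs_add, ofCoeffs_smul, h1] at h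
  simp only [map_add, MvPolynomial.eval_C, mul_one] at h
  linarith

end SumsOfSquares

/-! ### Polynomial functions on the support of a measure -/

theorem exists_eval_eq_on_finset (t : Finset (Fin N → ℝ)) (φ : (Fin N → ℝ) → ℝ) :
    ∃ p : MvPolynomial (Fin N) ℝ, ∀ z ∈ t, MvPolynomial.eval z p = φ z := by
  classical
  let r : (Fin N → ℝ) → MvPolynomial (Fin N) ℝ := fun y =>
    ∑ j, (MvPolynomial.X j - MvPolynomial.C (y j)) ^ 2
  have hr : ∀ y z, MvPolynomial.eval z (r y) = ∑ j, (z j - y j) ^ 2 := by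
    intro y z
    simp [r]
  have hr0 : ∀ y z, z ≠ y → MvPolynomial.eval z (r y) ≠ 0 := by
    intro y z hzy h
    rw [hr, Finset.sum_eq_zero_iff_of_nonneg fun j _ => sq_nonneg _] at h
    exact hzy (funext fun j => sub_eq_zero.1 (pow_eq_zero_iff two_ne_zero |>.1
      (h j (Finset.mem_univ j))))
  let L : (Fin N → ℝ) → MvPolynomial (Fin N) ℝ := fun z => ∏ y ∈ t.erase z, r y
  refine ⟨∑ z ∈ t, MvPolynomial.C (φ z / MvPolynomial.eval z (L z)) * L z, fun z hz => ?_⟩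
  rw [map_sum, Finset.sum_eq_single_of_mem z hz]
  · rw [map_mul, MvPolynomial.eval_C, div_mul_cancel₀]
    simp only [L, map_prod]
    exact Finset.prod_ne_zero_iff.2 fun y hy => hr0 y z (Finset.ne_of_mem_erase hy).symm
  · intro y _ hyz
    rw [map_mul]
    refine mul_eq_zero_of_right _ ?_
    simp only [L, map_prod]
    refine Finset.prod_eq_zero (Finset.mem_erase.2 ⟨hyz.symm, hz⟩) ?_
    rw [hr]
    simp

/-- If the polynomial functions on `Z` are spanned by `m` of them, then `Z` has at most `m` points. -/
theorem encard_le_of_forall_eval_eq_sum {Z : Set (Fin N → ℝ)} {m : ℕ}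
    (q : Fin m → MvPolynomial (Fin N) ℝ)
    (h : ∀ p : MvPolynomial (Fin N) ℝ, ∃ s : Fin m → ℝ, ∀ z ∈ Z,
      MvPolynomial.eval z p = ∑ i, s i * MvPolynomial.eval z (q i)) : Z.encard ≤ m := by
  by_contra! hlt
  obtain ⟨t, htZ, ht⟩ := Set.exists_subset_encard_eq (Order.add_one_le_of_lt hlt)
  have htfin : t.Finite := Set.finite_of_encard_eq_coe (k := m + 1) (by rw [ht]; norm_cast)
  lift t to Finset (Fin N → ℝ) using htfin
  rw [Set.encard_coe_eq_coe_finsetCard] at ht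
  let T : (Fin m → ℝ) →ₗ[ℝ] (t → ℝ) :=
    LinearMap.pi fun z => ∑ i, MvPolynomial.eval (z : Fin N → ℝ) (q i) • LinearMap.proj i
  have hT : Function.Surjective T := by
    intro φ
    obtain ⟨p, hp⟩ := exists_eval_eq_on_finset t fun z => if hz : z ∈ t then φ ⟨z, hz⟩ else 0
    obtain ⟨s, hs⟩ := h p
    refine ⟨s, funext fun z => ?_⟩
    have h1 := hp z z.2
    rw [hs z (htZ z.2)] at h1
    simpa [T, mul_comm] using h1
  have hle := LinearMap.finrank_le_finrank_of_surjective hT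
  simp only [Module.finrank_fintype_fun_eq_card, Fintype.card_fin, Fintype.card_coe] at hle
  have : t.card = m + 1 := by exact_mod_cast ht
  omega

/-- If the polynomials `q i` of degree less than `k` span the restrictions to `Z` of all
polynomials of degree at most `k`, they span the restrictions of all polynomials: a monomial can be
reduced by one variable at a time. -/
theorem forall_eval_eq_sum_of_restrictSupport {Z : Set (Fin N → ℝ)} {m k : ℕ}
    (q : Fin m → MvPolynomial (Fin N) ℝ) (hq : ∀ i, (q i).totalDegree < k)
    (h : ∀ p ∈ MvPolynomial.restrictSupport ℝ (powers N k : Set (Fin N →₀ ℕ)), ∃ s : Fin m → ℝ,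
      ∀ z ∈ Z, MvPolynomial.eval z p = ∑ i, s i * MvPolynomial.eval z (q i))
    (p : MvPolynomial (Fin N) ℝ) :
    ∃ s : Fin m → ℝ, ∀ z ∈ Z, MvPolynomial.eval z p = ∑ i, s i * MvPolynomial.eval z (q i) := by
  induction p using MvPolynomial.induction_on with
  | C c =>
    exact h _ ((MvPolynomial.monomial_mem_restrictSupport ℝ).2 (Or.inl (mem_powers.2 (by simp))))
  | add p p' hp hp' =>
    obtain ⟨s, hs⟩ := hp
    obtain ⟨s', hs'⟩ := hp'
    refine ⟨s + s', fun z hz => ?_⟩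
    simp [hs z hz, hs' z hz, add_mul, Finset.sum_add_distrib]
  | mul_X p j hp =>
    obtain ⟨s, hs⟩ := hp
    obtain ⟨s', hs'⟩ := h ((∑ i, MvPolynomial.C (s i) * q i) * MvPolynomial.X j) (by
      refine (MvPolynomial.mem_restrictSupport_iff ℝ).2 fun α hα => mem_powers.2 ?_
      refine (MvPolynomial.le_totalDegree hα).trans ((MvPolynomial.totalDegree_mul _ _).trans ?_)
      have hk : ∀ i, (MvPolynomial.C (s i) * q i).totalDegree ≤ k - 1 := fun i => by
        refine (MvPolynomial.totalDegree_mul _ _).trans ?_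
        rw [MvPolynomial.totalDegree_C, zero_add]
        exact Nat.le_sub_one_of_lt (hq i)
      have h1 : (∑ i, MvPolynomial.C (s i) * q i).totalDegree ≤ k - 1 :=
        MvPolynomial.totalDegree_finsetSum_le fun i _ => hk i
      rcases Nat.eq_zero_or_pos m with rfl | hm
      · simp at hα
      · have := hq ⟨0, hm⟩
        rw [MvPolynomial.totalDegree_X]
        omega)
    refine ⟨s', fun z hz => ?_⟩
    rw [← hs' z hz, map_mul, map_mul, hs z hz]
    simp

theorem isFiniteMeasure_of_mem_repMeasures {k : ℕ} {w : powers N k → ℝ} {K : Set (Fin N → ℝ)}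
    {μ : Measure (Fin N → ℝ)} (hμ : μ ∈ repMeasures w K) : IsFiniteMeasure μ := by
  have h := (hμ.2 ⟨0, mem_powers.2 (by simp)⟩).1
  simp only [Finsupp.coe_zero, Pi.zero_apply, pow_zero, Finset.prod_const_one] at h
  exact (integrable_const_iff.1 h).resolve_left one_ne_zero

theorem integrable_of_continuous_of_support_subset {K : Set (Fin N → ℝ)} (hK : IsCompact K)
    {μ : Measure (Fin N → ℝ)} [IsFiniteMeasure μ] (hμ : μ.support ⊆ K) {g : (Fin N → ℝ) → ℝ}
    (hg : Continuous g) : Integrable g μ := by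
  have hae : ∀ᵐ x ∂μ, x ∈ K := Filter.mem_of_superset μ.support_mem_ae hμ
  rw [← Measure.restrict_eq_self_of_ae_mem hae]
  exact hg.continuousOn.integrableOn_compact hK

/-- The vector `w + ∫ g(x) [x]_k dμ` is represented by the measure `(1 + g) μ`. -/
theorem add_mem_momentCone {K : Set (Fin N → ℝ)} (hK : IsCompact K) {k : ℕ}
    {w : powers N k → ℝ} {μ : Measure (Fin N → ℝ)} (hμ : μ ∈ repMeasures w K)
    {g : (Fin N → ℝ) → ℝ} (hg : Continuous g) (hgK : ∀ x ∈ K, -1 ≤ g x) :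
    (w + fun α : powers N k => ∫ x, g x * monomialVector (powers N k) x α ∂μ) ∈
      momentCone (powers N k) K := by
  have hfin := isFiniteMeasure_of_mem_repMeasures hμ
  have hae : ∀ᵐ x ∂μ, x ∈ K := Filter.mem_of_superset μ.support_mem_ae hμ.1
  have hmono : ∀ α : powers N k, Continuous fun x => monomialVector (powers N k) x α := fun α =>
    (continuous_apply α).comp continuous_monomialVector
  have hmeas : Measurable fun x => ENNReal.ofReal (1 + g x) := by
    have := hg.measurable
    fun_prop
  have hlt : ∀ᵐ x ∂μ, ENNReal.ofReal (1 + g x) < ⊤ := ae_of_all _ fun x => ENNReal.ofReal_lt_top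
  have hreal : ∀ α : powers N k, (fun x => (ENNReal.ofReal (1 + g x)).toReal •
      monomialVector (powers N k) x α) =ᵐ[μ]
      fun x => monomialVector (powers N k) x α + g x * monomialVector (powers N k) x α := by
    intro α
    filter_upwards [hae] with x hx
    rw [ENNReal.toReal_ofReal (by linarith [hgK x hx]), smul_eq_mul]
    ring
  have hi1 : ∀ α : powers N k, Integrable (fun x => monomialVector (powers N k) x α) μ := fun α =>
    integrable_of_continuous_of_support_subset hK hμ.1 (hmono α)
  have hi2 : ∀ α : powers N k, Integrable (fun x => g x * monomialVector (powers N k) x α) μ :=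
    fun α => integrable_of_continuous_of_support_subset hK hμ.1 (hg.mul (hmono α))
  refine ⟨μ.withDensity fun x => ENNReal.ofReal (1 + g x),
    (withDensity_absolutelyContinuous _ _).support_mono.trans hμ.1, fun α => ⟨?_, ?_⟩⟩
  · change Integrable (fun x => monomialVector (powers N k) x α) _
    rw [integrable_withDensity_iff_integrable_smul' hmeas hlt]
    exact ((hi1 α).add (hi2 α)).congr (hreal α).symm
  · change _ = ∫ x, monomialVector (powers N k) x α ∂_
    rw [integral_withDensity_eq_integral_toReal_smul hmeas hlt, integral_congr_ae (hreal α),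
      integral_add (hi1 α) (hi2 α), Pi.add_apply, (hμ.2 α).2]
    rfl

/-- The hypothesis `hw` says that `w` is an extreme point of the set of `w'` in the moment cone
with `⟨q i, w'⟩ = ⟨q i, w⟩` for all `i`. Then the `q i` span all polynomial functions on the support
of a representing measure. -/
theorem encard_support_le_of_extreme {K : Set (Fin N → ℝ)} (hK : IsCompact K) {k m : ℕ}
    (q : Fin m → MvPolynomial (Fin N) ℝ) (hq : ∀ i, (q i).totalDegree < k)
    {w : powers N k → ℝ}
    (hw : ∀ u, w + u ∈ momentCone (powers N k) K → w - u ∈ momentCone (powers N k) K →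
      (∀ i, pairing (q i) u = 0) → u = 0)
    {μ : Measure (Fin N → ℝ)} (hμ : μ ∈ repMeasures w K) : μ.support.encard ≤ m := by
  have hfin := isFiniteMeasure_of_mem_repMeasures hμ
  have hint : ∀ p : MvPolynomial (Fin N) ℝ, Integrable (fun x => MvPolynomial.eval x p) μ :=
    fun p => integrable_of_continuous_of_support_subset hK hμ.1 (MvPolynomial.continuous_eval p)
  have hqmem : ∀ i, q i ∈ MvPolynomial.restrictSupport ℝ (powers N k : Set (Fin N →₀ ℕ)) :=
    fun i => (MvPolynomial.mem_restrictSupport_iff ℝ).2 fun α hα =>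
      mem_powers.2 ((MvPolynomial.le_totalDegree hα).trans (hq i).le)
  -- `J p` is the functional `g ↦ ∫ g p dμ`
  let J : MvPolynomial (Fin N) ℝ → (MvPolynomial (Fin N) ℝ →ₗ[ℝ] ℝ) := fun p =>
    { toFun := fun g => ∫ x, MvPolynomial.eval x (g * p) ∂μ
      map_add' := fun g g' => by
        rw [← integral_add (hint _) (hint _)]
        simp [add_mul]
      map_smul' := fun c g => by
        rw [RingHom.id_apply, smul_eq_mul, ← integral_const_mul]
        simp }
  have hJ : ∀ p g, J p g = ∫ x, MvPolynomial.eval x (g * p) ∂μ := fun _ _ => rfl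
  have hpair : ∀ (g : MvPolynomial (Fin N) ℝ) (c : ℝ),
      ∀ p ∈ MvPolynomial.restrictSupport ℝ (powers N k : Set (Fin N →₀ ℕ)),
      pairing p (fun α : powers N k => ∫ x, c * MvPolynomial.eval x g *
        monomialVector (powers N k) x α ∂μ) = c * J p g := by
    intro g c p hp
    simp only [pairing, ← integral_const_mul, hJ]
    rw [← integral_finsetSum]
    · refine integral_congr_ae (ae_of_all _ fun x => ?_)
      simp only
      rw [map_mul, ← pairing_monomialVector hp, pairing, Finset.mul_sum, Finset.mul_sum]
      exact Finset.sum_congr rfl fun α _ => by ring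
    · intro α _
      refine integrable_of_continuous_of_support_subset hK hμ.1 ?_
      have h1 := MvPolynomial.continuous_eval g
      have h2 : Continuous fun x => monomialVector (powers N k) x α :=
        (continuous_apply α).comp continuous_monomialVector
      fun_prop
  -- a density orthogonal to all `q i` is orthogonal to every polynomial of degree at most `k`
  have hker : ∀ p ∈ MvPolynomial.restrictSupport ℝ (powers N k : Set (Fin N →₀ ℕ)),
      ⨅ i, LinearMap.ker (J (q i)) ≤ LinearMap.ker (J p) := by
    intro p hp g hg
    rw [Submodule.mem_iInf] at hg
    obtain ⟨B, hB⟩ := hK.exists_bound_of_continuousOn (MvPolynomial.continuous_eval g).continuousOn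
    set c : ℝ := (|B| + 1)⁻¹ with hc
    have hc0 : 0 < c := by positivity
    have hbound : ∀ x ∈ K, |c * MvPolynomial.eval x g| ≤ 1 := by
      intro x hx
      rw [abs_mul, abs_of_pos hc0, hc, inv_mul_le_iff₀ (by positivity), mul_one]
      exact ((hB x hx).trans (le_abs_self B)).trans (by linarith)
    have hcont : Continuous fun x => c * MvPolynomial.eval x g :=
      continuous_const.mul (MvPolynomial.continuous_eval g)
    have h0 := hw (fun α : powers N k => ∫ x, c * MvPolynomial.eval x g *
        monomialVector (powers N k) x α ∂μ)
      (add_mem_momentCone hK hμ hcont fun x hx => (abs_le.1 (hbound x hx)).1)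
      (by
        have := add_mem_momentCone hK hμ hcont.neg fun x hx => neg_le_neg (abs_le.1 (hbound x hx)).2
        simp only [Pi.neg_apply, neg_mul, integral_neg] at this
        exact this)
      (fun i => by rw [hpair g c _ (hqmem i), LinearMap.mem_ker.1 (hg i), mul_zero])
    have h1 := hpair g c p hp
    rw [h0, ← pairingCLM_apply, map_zero] at h1
    exact (mul_eq_zero.1 h1.symm).resolve_left hc0.ne'
  refine encard_le_of_forall_eval_eq_sum q
    (forall_eval_eq_sum_of_restrictSupport q hq fun p hp => ?_)
  obtain ⟨s, hs⟩ := (Submodule.mem_span_range_iff_exists_fun ℝ).1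
    (mem_span_of_iInf_ker_le_ker (hker p hp))
  set h := p - ∑ i, MvPolynomial.C (s i) * q i with hh
  -- `h` is orthogonal to all polynomials, in particular to itself
  have hzero : ∫ x, MvPolynomial.eval x h * MvPolynomial.eval x h ∂μ = 0 := by
    have h1 : ∑ i, s i * J (q i) h = J p h := by simpa using LinearMap.congr_fun hs h
    simp only [hJ, ← integral_const_mul] at h1
    rw [← integral_finsetSum _ fun i _ => (hint _).const_mul _, ← sub_eq_zero,
      ← integral_sub (integrable_finsetSum _ fun i _ => (hint _).const_mul _) (hint _)] at h1
    rw [← neg_eq_zero, ← integral_neg, ← h1]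
    refine integral_congr_ae (ae_of_all _ fun x => ?_)
    have h2 : MvPolynomial.eval x h =
        MvPolynomial.eval x p - ∑ i, s i * MvPolynomial.eval x (q i) := by simp [hh]
    simp only [map_mul]
    rw [mul_comm, neg_mul_eq_neg_mul, h2, neg_sub, sub_mul, Finset.sum_mul, ← h2]
    congr 1
    · exact Finset.sum_congr rfl fun i _ => by ring
    · ring
  have hae : ∀ᵐ x ∂μ, MvPolynomial.eval x h = 0 := by
    have h1 := (integral_eq_zero_iff_of_nonneg (fun x => mul_self_nonneg _)
      (by simpa only [map_mul] using hint (h * h))).1 hzero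
    exact h1.mono fun x hx => mul_self_eq_zero.1 hx
  have hcl : μ.support ⊆ {x | MvPolynomial.eval x h = 0} :=
    Measure.support_subset_of_isClosed
      (isClosed_eq (MvPolynomial.continuous_eval h) continuous_const) hae
  refine ⟨s, fun z hz => ?_⟩
  have h3 : MvPolynomial.eval z h = 0 := hcl hz
  rw [hh, map_sub, sub_eq_zero] at h3
  rw [h3]
  simp

/-! ### Unique minimizers over the moment cone -/

theorem hasAtomCount_of_unique_minimizer {K : Set (Fin N → ℝ)} (hK : IsCompact K) {k m m₁ : ℕ}
    {q : Fin m → MvPolynomial (Fin N) ℝ} (hq : ∀ i, (q i).totalDegree < k) {b : Fin m → ℝ}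
    {f : MvPolynomial (Fin N) ℝ} {w : powers N k → ℝ}
    (hw : IsMinimizer f (feasible m₁ (powers N k) K q b) w)
    (huniq : ∀ w', IsMinimizer f (feasible m₁ (powers N k) K q b) w' → w' = w)
    {μ : Measure (Fin N → ℝ)} (hμ : μ ∈ repMeasures w K) : ∃ r : ℕ, r ≤ m ∧ HasAtomCount r μ := by
  have hle : μ.support.encard ≤ m := by
    refine encard_support_le_of_extreme hK q hq (fun u hadd hsub hqu => ?_) hμ
    obtain ⟨⟨h1, h2, -⟩, hmin⟩ := hw
    have hpadd : ∀ p, pairing p (w + u) = pairing p w + pairing p u := fun p => by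
      simpa using (pairingCLM (powers N k) p).map_add w u
    have hpsub : ∀ p, pairing p (w - u) = pairing p w - pairing p u := fun p => by
      simpa using (pairingCLM (powers N k) p).map_sub w u
    have ha : w + u ∈ feasible m₁ (powers N k) K q b :=
      ⟨fun i hi => by rw [hpadd, hqu, add_zero, h1 i hi],
        fun i hi => by rw [hpadd, hqu, add_zero]; exact h2 i hi, hadd⟩
    have hs : w - u ∈ feasible m₁ (powers N k) K q b :=
      ⟨fun i hi => by rw [hpsub, hqu, sub_zero, h1 i hi],
        fun i hi => by rw [hpsub, hqu, sub_zero]; exact h2 i hi, hsub⟩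
    have hma := hmin _ ha
    have hms := hmin _ hs
    rw [hpadd] at hma
    rw [hpsub] at hms
    have := huniq (w + u) ⟨ha, fun w' hw' => by rw [hpadd]; linarith [hmin w' hw']⟩
    simpa using this
  obtain ⟨r, hr⟩ := ENat.ne_top_iff_exists.1 (ne_top_of_le_ne_top (ENat.natCast_ne_top m) hle)
  exact ⟨r, by rw [← hr] at hle; exact_mod_cast hle, hr.symm⟩

theorem ae_unique_minimizer (A : Finset (Fin N →₀ ℕ)) (F : Set (A → ℝ)) :
    ∀ᵐ f : A → ℝ, ∀ w w', IsMinimizer (ofCoeffs f) F w → IsMinimizer (ofCoeffs f) F w' →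
      w' = w := by
  classical
  choose Φ hΦ using exists_dual_eq_pairing (A := A)
  have hinj : ∀ w w', Φ w = Φ w' → w = w' := by
    intro w w' h
    funext α
    have h1 : ∀ w, Φ w (Pi.single α 1) = w α := fun w => by
      rw [hΦ, pairing]
      simp [coeff_ofCoeffs, Pi.single_apply]
    rw [← h1 w, ← h1 w', h]
  filter_upwards [ae_subsingleton_minimizers volume (Φ '' F)] with f hf w w' hw hw'
  refine hinj _ _ (hf ⟨⟨w', hw'.1, rfl⟩, ?_⟩ ⟨⟨w, hw.1, rfl⟩, ?_⟩)
  · rintro _ ⟨u, hu, rfl⟩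
    simpa only [hΦ] using hw'.2 u hu
  · rintro _ ⟨u, hu, rfl⟩
    simpa only [hΦ] using hw.2 u hu

theorem totalDegree_homogenize_le {n D : ℕ} {p : MvPolynomial (Fin n) ℝ} (hp : p.totalDegree ≤ D) :
    (homogenize D p).totalDegree ≤ D :=
  Finset.sup_le fun _ hα =>
    mem_powers.1 ((MvPolynomial.mem_restrictSupport_iff ℝ).1 (homogenize_mem le_rfl hp) hα)

end GTMP

theorem proposition4p1 {n : ℕ} {E I : Type*} [Finite E] [Finite I]
    (ceq : E → MvPolynomial (Fin n) ℝ) (cin : I → MvPolynomial (Fin n) ℝ)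
    (A : Finset (Fin n →₀ ℕ)) {m m₁ : ℕ} (hm : m₁ ≤ m)
    (a : Fin m → MvPolynomial (Fin n) ℝ)
    (ha : ∀ i, a i ∈ MvPolynomial.restrictSupport ℝ (A : Set (Fin n →₀ ℕ)))
    (b : Fin m → ℝ) (d₁ : ℕ) (hd : setDegree A < d₁) (hd₁ : Even d₁)
    (hfeas : (feasible m₁ A (semialgSet ceq cin) a b).Nonempty) :
    (∀ f ∈ interior (sosCone (n + 1) d₁), ∃ v : ℝ,
      IsLeast ((fun w => pairing (ofCoeffs f) w) ''
        feasible m₁ (powers (n + 1) d₁) (homSet ceq cin)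
          (fun i => homogenize (setDegree A) (a i)) b) v ∧
      IsLUB ((fun θ => ∑ i, b i * θ i) ''
        dualFeasible m₁ (powers (n + 1) d₁) (homSet ceq cin)
          (fun i => homogenize (setDegree A) (a i)) (ofCoeffs f)) v) ∧
    (∀ᵐ f : powers (n + 1) d₁ → ℝ, f ∈ sosCone (n + 1) d₁ →
      ∃ w : powers (n + 1) d₁ → ℝ,
        IsMinimizer (ofCoeffs f) (feasible m₁ (powers (n + 1) d₁) (homSet ceq cin)
          (fun i => homogenize (setDegree A) (a i)) b) w ∧
        (∀ w', IsMinimizer (ofCoeffs f) (feasible m₁ (powers (n + 1) d₁) (homSet ceq cin)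
          (fun i => homogenize (setDegree A) (a i)) b) w' → w' = w) ∧
        ∀ μ ∈ repMeasures w (homSet ceq cin), ∃ r : ℕ, r ≤ m ∧ HasAtomCount r μ) := by
  have hdeg := fun i => totalDegree_le_setDegree (ha i)
  have hK := isCompact_homSet ceq cin
  have hnonempty : (feasible m₁ (powers (n + 1) d₁) (homSet ceq cin)
      (fun i => homogenize (setDegree A) (a i)) b).Nonempty := by
    obtain ⟨y, hy1, hy2, hy⟩ := hfeas
    rw [momentCone_eq_hull] at hy
    obtain ⟨w, hw, hwy⟩ := exists_mem_hull_homogenize ceq cin hd.le hy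
    refine ⟨w, fun i hi => ?_, fun i hi => ?_, by rwa [momentCone_eq_hull]⟩
    · rw [hwy _ (ha i), hy1 i hi]
    · rw [hwy _ (ha i)]
      exact hy2 i hi
  have hduality : ∀ f ∈ interior (sosCone (n + 1) d₁), ∃ v : ℝ,
      IsLeast ((fun w => pairing (ofCoeffs f) w) ''
        feasible m₁ (powers (n + 1) d₁) (homSet ceq cin)
          (fun i => homogenize (setDegree A) (a i)) b) v ∧
      IsLUB ((fun θ => ∑ i, b i * θ i) ''
        dualFeasible m₁ (powers (n + 1) d₁) (homSet ceq cin)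
          (fun i => homogenize (setDegree A) (a i)) (ofCoeffs f)) v := by
    intro f hf
    obtain ⟨ε, hε, hfε⟩ := exists_pos_le_eval_of_mem_interior hf
    rw [feasible_eq_conicFeasible] at hnonempty ⊢
    rw [dualFeasible_eq m₁ _ (ofCoeffs_mem f) fun i => homogenize_mem hd.le (hdeg i)]
    have hpair : (fun w : powers (n + 1) d₁ → ℝ => pairing (ofCoeffs f) w) =
        pairingCLM (powers (n + 1) d₁) (ofCoeffs f) :=
      funext fun w => (pairingCLM_apply _ _).symm
    rw [hpair]
    refine conicProgramming_strong_duality _ _ _ _ _ (fun c => ?_) hnonempty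
    -- the coordinate of the constant monomial is `1` on the monomial vectors
    refine PointedCone.isCompact_hull_sublevel (hK.image continuous_monomialVector)
      (ContinuousLinearMap.proj ⟨0, mem_powers.2 (by simp)⟩) ?_ _ hε ?_ c
    · rintro _ ⟨x, -, rfl⟩
      simp [monomialVector]
    · rintro _ ⟨x, -, rfl⟩
      rw [pairingCLM_apply, pairing_monomialVector (ofCoeffs_mem f)]
      exact hfε x
  refine ⟨hduality, ?_⟩
  filter_upwards [ae_unique_minimizer (powers (n + 1) d₁) (feasible m₁ (powers (n + 1) d₁)
      (homSet ceq cin) (fun i => homogenize (setDegree A) (a i)) b),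
    measure_eq_zero_iff_ae_notMem.1 ((convex_sosCone (N := n + 1) d₁).addHaar_frontier volume)]
    with f huniq hfr hf
  have hint : f ∈ interior (sosCone (n + 1) d₁) := by
    by_contra h
    exact hfr ⟨subset_closure hf, h⟩
  obtain ⟨v, ⟨⟨w, hw, rfl⟩, hmin⟩, -⟩ := hduality f hint
  have hwmin : IsMinimizer (ofCoeffs f) (feasible m₁ (powers (n + 1) d₁) (homSet ceq cin)
      (fun i => homogenize (setDegree A) (a i)) b) w := ⟨hw, fun w' hw' => hmin ⟨w', hw', rfl⟩⟩
  refine ⟨w, hwmin, fun w' hw' => huniq w w' hwmin hw', fun μ hμ => ?_⟩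
  exact hasAtomCount_of_unique_minimizer hK
    (fun i => (totalDegree_homogenize_le (hdeg i)).trans_lt hd) hwmin
    (fun w' hw' => huniq w w' hwmin hw') hμ
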